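/- Let $(A,\mathfrak m)$ be a Noetherian local ring and let $(B,\mathfrak n)$ be a Noetherian local ring that is a flat $A$-algebra with $\mathfrak n=\mathfrak m B$. Let $X$ be a set, let $\mathcal U$ be an ultrafilter on $X$, and let $A_\natural=A^X/\mathcal U$ be the corresponding ultrapower of $A$ (families $X\to A$ modulo equality on a member of $\mathcal U$), regarded as an $A$-algebra via the diagonal map. Then every $A$-algebra homomorphism $B\to A_\natural$, if one exists, is faithfully flat. -/

import Mathlib

/-- The `A`-algebra structure on a reduced power `A^X / l`, given by `a ↦` the class of the
constant family with value `a`. The scalar multiplication is the pointwise one on germs. -/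
noncomputable instance Filter.Germ.instAlgebraReducedPower {X A : Type*} [CommRing A]
    (l : Filter X) : Algebra A (Filter.Germ l A) where
  algebraMap := (Filter.Germ.coeRingHom l).comp (Pi.constRingHom X A)
  commutes' _ _ := mul_comm _ _
  smul_def' a x := by
    induction x using Filter.Germ.inductionOn with
    | h f => rfl

/-- The ultrapower `A^X / U` of a commutative ring `A` along an ultrafilter `U` on a set `X`:
families `X → A` modulo equality on a member of `U`, with pointwise ring operations and the
diagonal `A`-algebra structure. -/
abbrev Ultrapower (A : Type*) {X : Type*} (U : Ultrafilter X) : Type _ :=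
  Filter.Germ (U : Filter X) A

/-!
Write `C` for the reduced power and `T I = Tor₁ (B ⧸ I, C)`. If `T` does not vanish, choose by
Noetherian induction an ideal `I` maximal with `T I ≠ 0`. If `I` contains the maximal ideal of `B`,
then `I` is extended from `A`, and `T I = 0` since `C` is flat over `A`. Otherwise some `x` in the
image of the maximal ideal of `A` lies outside `I`, so that `T (I + (x)) = 0` and
`T (I : x) → T I` is onto; by maximality `(I : x) = I`, and hence `x • T I = T I`. Now `T I` is the
homology of a complex of finite free modules over `C`, that is, of germs of complexes over `A`;
Nakayama's lemma, applied to the homology of almost every one of these, gives `T I = 0`.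
-/

open Filter TensorProduct
open scoped Matrix Pointwise

section TorOne

variable {R : Type*} [CommRing R]

/-- `Tor₁ (R ⧸ I, M)`, realised as the kernel of `I ⊗ M → R ⊗ M`. -/
def torOne (I : Ideal R) (M : Type*) [AddCommGroup M] [Module R M] : Submodule R (I ⊗[R] M) :=
  LinearMap.ker (I.subtype.rTensor M)

/-- Multiplication by `x`, as a map from the colon ideal `(I : x)` to `I`. -/
def mulColon (I : Ideal R) (x : R) : I.colon {x} →ₗ[R] I :=
  (LinearMap.lsmul R R x).restrict fun t ht ↦ by
    rw [LinearMap.lsmul_apply, smul_eq_mul, mul_comm]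
    exact Submodule.mem_colon_singleton.1 ht

/-- The surjection `(i, r) ↦ i + r x` from `I × R` onto the ideal `I + (x)`. -/
def prodToSup (I : Ideal R) (x : R) : I × R →ₗ[R] (I ⊔ Ideal.span {x} : Ideal R) :=
  (Submodule.inclusion le_sup_left).coprod
    (LinearMap.toSpanSingleton R _ ⟨x, Ideal.mem_sup_right (Ideal.mem_span_singleton_self x)⟩)

theorem coe_prodToSup (I : Ideal R) (x : R) (p : I × R) :
    (prodToSup I x p : R) = p.1 + p.2 * x := rfl

theorem prodToSup_surjective (I : Ideal R) (x : R) : Function.Surjective (prodToSup I x) := by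
  rintro ⟨y, hy⟩
  obtain ⟨i, hi, z, hz, rfl⟩ := Submodule.mem_sup.1 hy
  obtain ⟨r, rfl⟩ := Ideal.mem_span_singleton'.1 hz
  exact ⟨(⟨i, hi⟩, r), rfl⟩

theorem exact_mulColon_prodToSup (I : Ideal R) (x : R) :
    Function.Exact ((mulColon I x).prod (-(I.colon {x}).subtype)) (prodToSup I x) := by
  rintro ⟨i, r⟩
  rw [← ZeroMemClass.coe_eq_zero, coe_prodToSup]
  constructor
  · intro h
    have hi : x * -r = i := by linear_combination -h
    have hr : -r ∈ I.colon {x} := by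
      rw [Submodule.mem_colon_singleton, smul_eq_mul, mul_comm, hi]
      exact i.2
    exact ⟨⟨-r, hr⟩, Prod.ext (Subtype.ext hi) (neg_neg r)⟩
  · rintro ⟨t, ht⟩
    obtain ⟨rfl, rfl⟩ := Prod.ext_iff.1 ht
    change x * (t : R) + -(t : R) * x = 0
    ring

variable {M : Type*} [AddCommGroup M] [Module R M]

-- This is the exactness of `Tor₁ (R ⧸ (I : x), M) → Tor₁ (R ⧸ I, M) → Tor₁ (R ⧸ (I + (x)), M)`.
theorem torOne_le_map_mulColon {I : Ideal R} {x : R} (h : torOne (I ⊔ Ideal.span {x}) M = ⊥) :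
    torOne I M ≤ (torOne (I.colon {x}) M).map ((mulColon I x).rTensor M) := by
  intro τ hτ
  have hinl : (prodToSup I x).rTensor M ((LinearMap.inl R I R).rTensor M τ) = 0 := by
    apply LinearMap.ker_eq_bot.1 h
    have hcomp : (I ⊔ Ideal.span {x} : Ideal R).subtype ∘ₗ prodToSup I x ∘ₗ LinearMap.inl R I R =
        I.subtype := by
      ext i
      simp [coe_prodToSup]
    simpa only [map_zero, ← LinearMap.rTensor_comp_apply, hcomp] using LinearMap.mem_ker.1 hτ
  obtain ⟨ω, hω⟩ := (rTensor_exact M (exact_mulColon_prodToSup I x) (prodToSup_surjective I x) _).1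
    hinl
  refine ⟨ω, ?_, ?_⟩
  · rw [SetLike.mem_coe, torOne, LinearMap.mem_ker]
    have hsnd := congrArg ((LinearMap.snd R I R).rTensor M) hω
    simpa [← LinearMap.rTensor_comp_apply] using hsnd
  · have hfst := congrArg ((LinearMap.fst R I R).rTensor M) hω
    simpa [← LinearMap.rTensor_comp_apply] using hfst

theorem torOne_le_smul_of_colon_le {I : Ideal R} {x : R}
    (h : torOne (I ⊔ Ideal.span {x}) M = ⊥) (hI : I.colon {x} ≤ I) :
    torOne I M ≤ x • torOne I M := by
  intro τ hτ
  obtain ⟨ω, hω, rfl⟩ := torOne_le_map_mulColon h hτ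
  have hmul : mulColon I x = x • Submodule.inclusion hI := rfl
  rw [hmul, LinearMap.rTensor_smul, LinearMap.smul_apply]
  refine Submodule.smul_mem_pointwise_smul _ _ _ ?_
  rwa [torOne, LinearMap.mem_ker, ← LinearMap.rTensor_comp_apply, Submodule.subtype_comp_inclusion]

theorem flat_of_torOne_eq_bot [IsNoetherianRing R] (s : Set R)
    (hle : ∀ I : Ideal R, Ideal.span s ≤ I → torOne I M = ⊥)
    (hsmul : ∀ x ∈ s, ∀ I : Ideal R, torOne I M ≤ x • torOne I M → torOne I M = ⊥) :
    Module.Flat R M := by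
  rw [Module.Flat.iff_rTensor_injective']
  intro I
  rw [← LinearMap.ker_eq_bot]
  change torOne I M = ⊥
  induction I using WellFoundedGT.induction with
  | ind I ih =>
  by_cases hs : s ⊆ I
  · exact hle I (Ideal.span_le.2 hs)
  obtain ⟨x, hx, hxI⟩ := Set.not_subset.1 hs
  have hsup : torOne (I ⊔ Ideal.span {x}) M = ⊥ :=
    ih _ (left_lt_sup.2 fun hxle ↦ hxI (hxle (Ideal.mem_span_singleton_self x)))
  obtain hlt | heq := (Ideal.le_colon (I := I) (S := {x})).lt_or_eq
  · simpa only [ih _ hlt, Submodule.map_bot, le_bot_iff] using torOne_le_map_mulColon hsup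
  · exact hsmul x hx I (torOne_le_smul_of_colon_le hsup heq.ge)

end TorOne

section Generators

variable {R M N ι : Type*} [CommRing R] [AddCommGroup M] [Module R M] [AddCommGroup N] [Module R N]

theorem exists_finsupp_sum_tmul_eq {b : ι → M} (hb : Submodule.span R (Set.range b) = ⊤)
    (τ : M ⊗[R] N) : ∃ c : ι →₀ N, (c.sum fun i y ↦ b i ⊗ₜ y) = τ := by
  classical
  induction τ with
  | zero => exact ⟨0, Finsupp.sum_zero_index⟩
  | add τ σ hτ hσ =>
    obtain ⟨c, rfl⟩ := hτ
    obtain ⟨d, rfl⟩ := hσ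
    exact ⟨c + d, Finsupp.sum_add_index' (fun i ↦ tmul_zero N (b i)) fun i ↦ tmul_add (b i)⟩
  | tmul m y =>
    obtain ⟨r, rfl⟩ := Finsupp.mem_span_range_iff_exists_finsupp.1
      (hb ▸ Submodule.mem_top : m ∈ Submodule.span R (Set.range b))
    refine ⟨r.mapRange (· • y) (zero_smul R y), ?_⟩
    rw [Finsupp.sum_mapRange_index fun i ↦ tmul_zero N (b i), Finsupp.sum, Finsupp.sum, sum_tmul]
    simp_rw [smul_tmul]

theorem exists_sum_tmul_eq [Fintype ι] {b : ι → M} (hb : Submodule.span R (Set.range b) = ⊤)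
    (τ : M ⊗[R] N) : ∃ c : ι → N, ∑ i, b i ⊗ₜ c i = τ := by
  obtain ⟨c, rfl⟩ := exists_finsupp_sum_tmul_eq hb τ
  exact ⟨c, (c.sum_fintype _ fun i ↦ tmul_zero N (b i)).symm⟩

theorem exists_range_mulVecLin_eq {P : Submodule R (ι → R)} (hP : P.FG) :
    ∃ (r : ℕ) (σ : Matrix ι (Fin r) R), LinearMap.range σ.mulVecLin = P := by
  obtain ⟨r, g, rfl⟩ := Submodule.fg_iff_exists_fin_generating_family.1 hP
  exact ⟨r, .of fun i j ↦ g j i, Matrix.range_mulVecLin _⟩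

theorem sum_tmul_mem_torOne_iff [Fintype ι] {I : Ideal R} (b : ι → I) (c : ι → N) :
    ∑ i, b i ⊗ₜ[R] c i ∈ torOne I N ↔ ∑ i, (b i : R) • c i = 0 := by
  rw [torOne, LinearMap.mem_ker, ← (TensorProduct.lid R N).map_eq_zero_iff]
  simp

theorem sum_tmul_eq_zero_iff_exists_syzygy [Fintype ι] {κ : Type*} [Fintype κ] {b : ι → M}
    (hb : Submodule.span R (Set.range b) = ⊤) {σ : Matrix ι κ R}
    (hσ : LinearMap.range σ.mulVecLin = LinearMap.ker (Fintype.linearCombination R b))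
    (c : ι → N) :
    ∑ i, b i ⊗ₜ[R] c i = 0 ↔ ∃ u : κ → N, ∀ i, c i = ∑ j, σ i j • u j := by
  classical
  constructor
  · intro h
    obtain ⟨k, s, y, hy, hs⟩ := vanishesTrivially_of_sum_tmul_eq_zero R hb h
    have hmem (j : Fin k) : (fun i ↦ s i j) ∈ LinearMap.range σ.mulVecLin := by
      rw [hσ, LinearMap.mem_ker, Fintype.linearCombination_apply]
      exact hs j
    choose v hv using hmem
    refine ⟨fun q ↦ ∑ j, v j q • y j, fun i ↦ ?_⟩
    have hsi (j : Fin k) : s i j = ∑ q, σ i q * v j q := (congrFun (hv j) i).symm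
    simp_rw [hy, hsi, Finset.sum_smul, Finset.smul_sum, mul_smul]
    exact Finset.sum_comm
  · rintro ⟨u, hu⟩
    have hcol (j : κ) : ∑ i, σ i j • b i = 0 := by
      have hmem : σ.col j ∈ LinearMap.range σ.mulVecLin :=
        ⟨Pi.single j 1, Matrix.mulVec_single_one σ j⟩
      rwa [hσ, LinearMap.mem_ker, Fintype.linearCombination_apply] at hmem
    exact sum_tmul_eq_zero_of_vanishesTrivially R (.of_fintype _ u hu hcol)

end Generators

section Extension

variable {A B C : Type*} [CommRing A] [CommRing B] [Algebra A B] [AddCommGroup C] [Module A C]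
  [Module B C] [IsScalarTower A B C]

theorem torOne_map_algebraMap_eq_bot [Module.Flat A C] (I : Ideal A) :
    torOne (I.map (algebraMap A B)) C = ⊥ := by
  let b (a : I) : I.map (algebraMap A B) :=
    ⟨algebraMap A B a, Ideal.mem_map_of_mem (algebraMap A B) a.2⟩
  have hb : Submodule.span B (Set.range b) = ⊤ := by
    apply Submodule.map_injective_of_injective (Submodule.injective_subtype _)
    rw [Submodule.map_span, Submodule.map_subtype_top, ← Set.range_comp]
    exact congrArg (Submodule.span B) (Set.image_eq_range _ _).symm
  rw [eq_bot_iff]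
  intro τ hτ
  obtain ⟨c, rfl⟩ := exists_finsupp_sum_tmul_eq hb τ
  rw [Finsupp.sum, ← Finset.sum_coe_sort, sum_tmul_mem_torOne_iff] at hτ
  have hrel : ∑ a : c.support, (a : A) • c a = 0 := by
    simpa only [b, algebraMap_smul] using hτ
  obtain ⟨k, s, y, hy, hs⟩ := Module.Flat.isTrivialRelation_of_sum_smul_eq_zero hrel
  rw [Finsupp.sum, ← Finset.sum_coe_sort]
  refine sum_tmul_eq_zero_of_vanishesTrivially B
    ⟨k, fun a j ↦ algebraMap A B (s a j), y, fun a ↦ ?_, fun j ↦ Subtype.ext ?_⟩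
  · simpa only [algebraMap_smul] using hy a
  · have hmap := congrArg (algebraMap A B) (hs j)
    simp only [map_sum, map_mul, map_zero] at hmap
    simpa only [b, AddSubmonoidClass.coe_finsetSum, SetLike.val_smul, smul_eq_mul, mul_comm,
      ZeroMemClass.coe_zero] using hmap

theorem faithfullyFlat_of_maximalIdeal_eq_map [IsLocalRing A] [IsLocalRing B]
    [Module.FaithfullyFlat A C] [Module.Flat B C]
    (hmax : IsLocalRing.maximalIdeal B =
      (IsLocalRing.maximalIdeal A).map (algebraMap A B)) :
    Module.FaithfullyFlat B C := by
  refine ⟨fun {n} hn htop ↦ ?_⟩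
  rw [IsLocalRing.eq_maximalIdeal hn, hmax] at htop
  have htopA := congrArg (Submodule.restrictScalars A) htop
  rw [Ideal.smul_restrictScalars, Submodule.restrictScalars_top] at htopA
  exact Module.FaithfullyFlat.submodule_ne_top (IsLocalRing.maximalIdeal.isMaximal A) htopA

end Extension

section Germ

variable {A X V W : Type*} [CommRing A] [AddCommGroup V] [Module A V] [AddCommGroup W] [Module A W]
  {l : Filter X}

/-- The `A`-linear map on germs induced by a family of `A`-linear maps. -/
def germMap (l : Filter X) (T : X → V →ₗ[A] W) : Germ l V →ₗ[A] Germ l W where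
  toFun := Germ.map₂ (fun S v ↦ S v) (T : Germ l (V →ₗ[A] W))
  map_add' x y := Germ.inductionOn₂ x y fun f g ↦
    congrArg Germ.ofFun (funext fun ξ ↦ map_add (T ξ) (f ξ) (g ξ))
  map_smul' a x := Germ.inductionOn x fun f ↦
    congrArg Germ.ofFun (funext fun ξ ↦ map_smul (T ξ) a (f ξ))

theorem germMap_coe (T : X → V →ₗ[A] W) (f : X → V) :
    germMap l T (f : Germ l V) = ((fun ξ ↦ T ξ (f ξ) : X → W) : Germ l W) := rfl

/-- The internal submodule defined by a family `P` of submodules of `V`: the germs of the families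
of vectors that lie in `P` eventually along `l`. -/
def internalSubmodule (l : Filter X) (P : X → Submodule A V) : Submodule A (Germ l V) where
  carrier := {x | Germ.LiftRel (· ∈ ·) x (P : Germ l (Submodule A V))}
  zero_mem' := Eventually.of_forall fun ξ ↦ (P ξ).zero_mem
  add_mem' {x y} := Germ.inductionOn₂ x y fun _ _ hf hg ↦
    hf.mp (hg.mono fun ξ hgξ hfξ ↦ (P ξ).add_mem hfξ hgξ)
  smul_mem' a x := Germ.inductionOn x fun _ hf ↦ hf.mono fun ξ ↦ (P ξ).smul_mem a

theorem coe_mem_internalSubmodule {P : X → Submodule A V} {f : X → V} :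
    (f : Germ l V) ∈ internalSubmodule l P ↔ ∀ᶠ ξ in l, f ξ ∈ P ξ := Iff.rfl

theorem internalSubmodule_le_internalSubmodule_iff {P Q : X → Submodule A V} :
    internalSubmodule l P ≤ internalSubmodule l Q ↔ ∀ᶠ ξ in l, P ξ ≤ Q ξ := by
  constructor
  · intro h
    have hwitness (ξ : X) : ∃ v ∈ P ξ, v ∈ Q ξ → P ξ ≤ Q ξ := by
      by_cases hle : P ξ ≤ Q ξ
      · exact ⟨0, zero_mem _, fun _ ↦ hle⟩
      · obtain ⟨v, hvP, hvQ⟩ := SetLike.not_le_iff_exists.1 hle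
        exact ⟨v, hvP, fun hv ↦ absurd hv hvQ⟩
    choose f hfP hfQ using hwitness
    have hf : (f : Germ l V) ∈ internalSubmodule l Q := h (Eventually.of_forall hfP)
    exact (coe_mem_internalSubmodule.1 hf).mono hfQ
  · intro h x
    induction x using Germ.inductionOn with
    | h f => exact fun hf ↦ h.mp (hf.mono fun ξ hξ hle ↦ hle hξ)

theorem ker_germMap (T : X → V →ₗ[A] W) :
    LinearMap.ker (germMap l T) = internalSubmodule l fun ξ ↦ LinearMap.ker (T ξ) := by
  ext x
  induction x using Germ.inductionOn with
  | h f => exact Germ.coe_eq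

theorem range_germMap (T : X → V →ₗ[A] W) :
    LinearMap.range (germMap l T) = internalSubmodule l fun ξ ↦ LinearMap.range (T ξ) := by
  ext y
  induction y using Germ.inductionOn with
  | h g =>
  constructor
  · rintro ⟨x, hx⟩
    induction x using Germ.inductionOn with
    | h f => exact (Germ.coe_eq.1 hx).mono fun ξ hξ ↦ ⟨f ξ, hξ⟩
  · intro hg
    choose! f hf using fun (ξ : X) (hξ : g ξ ∈ LinearMap.range (T ξ)) ↦ hξ
    exact ⟨(f : Germ l V), Germ.coe_eq.2 ((coe_mem_internalSubmodule.1 hg).mono hf)⟩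

theorem sup_smul_internalSubmodule_le (P Q : X → Submodule A V) (a : A) :
    internalSubmodule l Q ⊔ a • internalSubmodule l P ≤
      internalSubmodule l fun ξ ↦ Q ξ ⊔ a • P ξ := by
  refine sup_le (internalSubmodule_le_internalSubmodule_iff.2 (.of_forall fun ξ ↦ le_sup_left)) ?_
  rintro _ ⟨x, hx, rfl⟩
  induction x using Germ.inductionOn with
  | h f =>
  exact (coe_mem_internalSubmodule.1 hx).mono fun ξ hξ ↦
    Submodule.mem_sup_right (Submodule.smul_mem_pointwise_smul _ _ _ hξ)

-- `internalSubmodule l P` need not be finitely generated over the ring of germs, so Nakayama's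
-- lemma is applied to almost every `P ξ` instead.
theorem internalSubmodule_le_of_le_sup_smul {P Q : X → Submodule A V} (hP : ∀ ξ, (P ξ).FG) {a : A}
    (ha : a ∈ Ideal.jacobson (⊥ : Ideal A))
    (h : internalSubmodule l P ≤ internalSubmodule l Q ⊔ a • internalSubmodule l P) :
    internalSubmodule l P ≤ internalSubmodule l Q := by
  rw [internalSubmodule_le_internalSubmodule_iff]
  filter_upwards [internalSubmodule_le_internalSubmodule_iff.1
    (h.trans (sup_smul_internalSubmodule_le P Q a))] with ξ hξ
  refine Submodule.le_of_le_smul_of_le_jacobson_bot (I := Ideal.span {a}) (hP ξ)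
    ((Ideal.span_singleton_le_iff_mem _).2 ha) ?_
  rwa [Submodule.ideal_span_singleton_smul]

theorem smul_top_le_internalSubmodule (I : Ideal A) :
    I • (⊤ : Submodule A (Germ l A)) ≤ internalSubmodule l fun _ ↦ I := by
  refine Submodule.smul_le.2 fun a ha x _ ↦ ?_
  induction x using Germ.inductionOn with
  | h f => exact Eventually.of_forall fun ξ ↦ I.mul_mem_right _ ha

theorem smul_top_germ_ne_top [l.NeBot] {I : Ideal A} (hI : I ≠ ⊤) :
    I • (⊤ : Submodule A (Germ l A)) ≠ ⊤ := by
  intro htop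
  have hone : (1 : Germ l A) ∈ internalSubmodule l fun _ ↦ I :=
    smul_top_le_internalSubmodule I (htop.symm.le Submodule.mem_top)
  obtain ⟨_, hmem⟩ := hone.exists
  exact hI ((Ideal.eq_top_iff_one I).2 hmem)

end Germ

section Matrix

variable {A X ι κ ν : Type*} [CommRing A] {l : Filter X}

/-- The germs of the coordinates of the germ of a family of vectors. -/
def germPi (A ι : Type*) [CommRing A] (l : Filter X) : Germ l (ι → A) →ₗ[A] (ι → Germ l A) where
  toFun x i := x.map (· i)
  map_add' x y := Germ.inductionOn₂ x y fun _ _ ↦ rfl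
  map_smul' _ x := Germ.inductionOn x fun _ ↦ rfl

theorem germPi_injective [Finite ι] : Function.Injective (germPi A ι l) := by
  intro x y
  induction x, y using Germ.inductionOn₂ with
  | h f g =>
  intro h
  have hcoord (i : ι) : ∀ᶠ ξ in l, f ξ i = g ξ i := Germ.coe_eq.1 (congrFun h i)
  exact Germ.coe_eq.2 ((eventually_all.2 hcoord).mono fun _ ↦ funext)

theorem germPi_surjective : Function.Surjective (germPi A ι l) := by
  intro c
  choose f hf using fun i ↦ Quotient.exists_rep (c i)
  exact ⟨((fun ξ i ↦ f i ξ : X → ι → A) : Germ l (ι → A)), funext hf⟩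

theorem germPi_germMap_mulVecLin [Fintype ι] (b : X → Matrix κ ι A)
    (x : Germ l (ι → A)) :
    germPi A κ l (germMap l (fun ξ ↦ (b ξ).mulVecLin) x) =
      (Matrix.of fun k i ↦ ((b · k i) : Germ l A)) *ᵥ germPi A ι l x := by
  induction x using Germ.inductionOn with
  | h f =>
  ext k
  change Germ.coeRingHom l (fun ξ ↦ ∑ i, b ξ k i * f ξ i) =
    ∑ i, Germ.coeRingHom l (fun ξ ↦ b ξ k i) * Germ.coeRingHom l (fun ξ ↦ f ξ i)
  simp_rw [← map_mul, ← map_sum]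
  congr 1
  ext ξ
  simp

theorem exists_germMap_mulVecLin [Fintype ι] (M : Matrix κ ι (Germ l A)) :
    ∃ b : X → Matrix κ ι A, ∀ x : Germ l (ι → A),
      germPi A κ l (germMap l (fun ξ ↦ (b ξ).mulVecLin) x) =
        M *ᵥ germPi A ι l x := by
  choose b hb using fun k i ↦ Quotient.exists_rep (M k i)
  refine ⟨fun ξ ↦ .of fun k i ↦ b k i ξ, fun x ↦ ?_⟩
  rw [germPi_germMap_mulVecLin]
  congr 1
  ext k i
  exact hb k i

theorem exists_mulVec_eq_of_forall_exists_add_smul [IsNoetherianRing A] [Fintype ι] [Finite κ]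
    [Fintype ν] (M : Matrix κ ι (Germ l A)) (N : Matrix ι ν (Germ l A)) {a : A}
    (ha : a ∈ Ideal.jacobson (⊥ : Ideal A))
    (h : ∀ c, M *ᵥ c = 0 → ∃ u d, M *ᵥ d = 0 ∧ c = N *ᵥ u + a • d)
    {c : ι → Germ l A} (hc : M *ᵥ c = 0) : ∃ u, c = N *ᵥ u := by
  obtain ⟨m, hm⟩ := exists_germMap_mulVecLin M
  obtain ⟨n, hn⟩ := exists_germMap_mulVecLin N
  have mem_ker_iff (x : Germ l (ι → A)) :
      x ∈ LinearMap.ker (germMap l fun ξ ↦ (m ξ).mulVecLin) ↔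
        M *ᵥ germPi A ι l x = 0 := by
    rw [LinearMap.mem_ker, ← hm, map_eq_zero_iff _ germPi_injective]
  have hle : LinearMap.ker (germMap l fun ξ ↦ (m ξ).mulVecLin) ≤
      LinearMap.range (germMap l fun ξ ↦ (n ξ).mulVecLin) := by
    rw [ker_germMap, range_germMap]
    refine internalSubmodule_le_of_le_sup_smul (fun ξ ↦ IsNoetherian.noetherian _) ha ?_
    rw [← ker_germMap, ← range_germMap]
    intro x hx
    obtain ⟨u, d, hd, hxd⟩ := h _ ((mem_ker_iff x).1 hx)
    obtain ⟨u, rfl⟩ := germPi_surjective u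
    obtain ⟨d, rfl⟩ := germPi_surjective d
    rw [← hn, ← map_smul, ← map_add, germPi_injective.eq_iff] at hxd
    rw [hxd]
    exact Submodule.add_mem_sup (LinearMap.mem_range_self _ u)
      (Submodule.smul_mem_pointwise_smul _ _ _ ((mem_ker_iff d).2 hd))
  obtain ⟨x, rfl⟩ := germPi_surjective c
  obtain ⟨u, rfl⟩ := hle ((mem_ker_iff x).2 hc)
  exact ⟨_, hn u⟩

end Matrix

section Flat

variable {A B X : Type*} [CommRing A] [IsNoetherianRing A] {l : Filter X}

instance flat_germ : Module.Flat A (Germ l A) := by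
  refine Module.Flat.of_forall_isTrivialRelation fun {n f c} hc ↦ ?_
  let F : Matrix Unit (Fin n) A := Matrix.replicateRow Unit f
  obtain ⟨r, σ, hσ⟩ := exists_range_mulVecLin_eq
    (IsNoetherian.noetherian (LinearMap.ker F.mulVecLin))
  obtain ⟨x, rfl⟩ := germPi_surjective c
  have hx : x ∈ LinearMap.ker (germMap l fun _ ↦ F.mulVecLin) := by
    rw [LinearMap.mem_ker, ← map_eq_zero_iff _ germPi_injective, germPi_germMap_mulVecLin]
    exact funext fun _ ↦ hc
  rw [ker_germMap, ← hσ, ← range_germMap] at hx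
  obtain ⟨u, rfl⟩ := hx
  refine ⟨r, σ, germPi A (Fin r) l u, fun i ↦ ?_, fun j ↦ ?_⟩
  · exact congrFun (germPi_germMap_mulVecLin (fun _ ↦ σ) u) i
  · have hcol : σ.col j ∈ LinearMap.ker F.mulVecLin :=
      hσ ▸ ⟨Pi.single j 1, Matrix.mulVec_single_one σ j⟩
    exact congrFun hcol ()

instance faithfullyFlat_germ [l.NeBot] : Module.FaithfullyFlat A (Germ l A) :=
  ⟨fun {_} hm ↦ smul_top_germ_ne_top hm.ne_top⟩

variable [CommRing B] [Algebra A B] [Algebra B (Germ l A)] [IsScalarTower A B (Germ l A)]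

theorem torOne_germ_eq_bot_of_le_smul [IsNoetherianRing B] {I : Ideal B} {a : A}
    (ha : a ∈ Ideal.jacobson (⊥ : Ideal A))
    (h : torOne I (Germ l A) ≤ algebraMap A B a • torOne I (Germ l A)) :
    torOne I (Germ l A) = ⊥ := by
  obtain ⟨n, b, hb⟩ := Submodule.fg_iff_exists_fin_generating_family.1
    (Module.Finite.fg_top : (⊤ : Submodule B I).FG)
  obtain ⟨r, σ, hσ⟩ := exists_range_mulVecLin_eq
    (IsNoetherian.noetherian (LinearMap.ker (Fintype.linearCombination B b)))
  let M : Matrix Unit (Fin n) (Germ l A) :=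
    Matrix.replicateRow Unit fun i ↦ algebraMap B (Germ l A) (b i)
  let N : Matrix (Fin n) (Fin r) (Germ l A) := σ.map (algebraMap B (Germ l A))
  have mem_torOne_iff (c : Fin n → Germ l A) :
      ∑ i, b i ⊗ₜ[B] c i ∈ torOne I (Germ l A) ↔ M *ᵥ c = 0 := by
    simp [sum_tmul_mem_torOne_iff, M, funext_iff, Matrix.mulVec, dotProduct, Algebra.smul_def]
  have sum_tmul_eq_zero_iff (c : Fin n → Germ l A) :
      ∑ i, b i ⊗ₜ[B] c i = 0 ↔ ∃ u, c = N *ᵥ u := by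
    simp [sum_tmul_eq_zero_iff_exists_syzygy hb hσ, N, funext_iff, Matrix.mulVec, dotProduct,
      Algebra.smul_def]
  rw [eq_bot_iff]
  intro τ hτ
  obtain ⟨c, rfl⟩ := exists_sum_tmul_eq hb τ
  refine (sum_tmul_eq_zero_iff c).2 (exists_mulVec_eq_of_forall_exists_add_smul M N ha ?_
    ((mem_torOne_iff c).1 hτ))
  intro c hc
  obtain ⟨ω, hω, hcω⟩ := h ((mem_torOne_iff c).2 hc)
  obtain ⟨d, rfl⟩ := exists_sum_tmul_eq hb ω
  have hsub : ∑ i, b i ⊗ₜ[B] (c - a • d) i = 0 := by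
    replace hcω : algebraMap A B a • ∑ i, b i ⊗ₜ[B] d i = ∑ i, b i ⊗ₜ[B] c i := hcω
    simp [tmul_sub, ← hcω, Finset.smul_sum, ← tmul_smul]
  obtain ⟨u, hu⟩ := (sum_tmul_eq_zero_iff _).1 hsub
  exact ⟨u, d, (mem_torOne_iff d).1 hω, sub_eq_iff_eq_add.1 hu⟩

theorem flat_germ_of_maximalIdeal_eq_map [IsNoetherianRing B] [IsLocalRing A] [IsLocalRing B]
    (hmax : IsLocalRing.maximalIdeal B =
      (IsLocalRing.maximalIdeal A).map (algebraMap A B)) :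
    Module.Flat B (Germ l A) := by
  refine flat_of_torOne_eq_bot (algebraMap A B '' IsLocalRing.maximalIdeal A) (fun I hI ↦ ?_) ?_
  · change Ideal.map _ _ ≤ I at hI
    obtain rfl | htop := eq_or_ne I ⊤
    · rw [← Ideal.map_top (algebraMap A B)]
      exact torOne_map_algebraMap_eq_bot ⊤
    · rw [← hmax] at hI
      rw [hI.antisymm' (IsLocalRing.le_maximalIdeal htop), hmax]
      exact torOne_map_algebraMap_eq_bot _
  · rintro _ ⟨a, ha, rfl⟩ I hI
    rw [SetLike.mem_coe, ← IsLocalRing.jacobson_eq_maximalIdeal ⊥ bot_ne_top] at ha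
    exact torOne_germ_eq_bot_of_le_smul ha hI

end Flat

theorem mainTheorem3_general
    {A B X : Type*}
    [CommRing A] [IsLocalRing A] [IsNoetherianRing A]
    [CommRing B] [IsLocalRing B] [IsNoetherianRing B]
    [Algebra A B]
    (hmax : IsLocalRing.maximalIdeal B =
      (IsLocalRing.maximalIdeal A).map (algebraMap A B))
    (l : Filter X) [l.NeBot]
    (φ : B →ₐ[A] Germ l A) :
    (φ : B →+* Germ l A).FaithfullyFlat := by
  let : Algebra B (Germ l A) := (φ : B →+* Germ l A).toAlgebra
  have : IsScalarTower A B (Germ l A) :=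
    IsScalarTower.of_algebraMap_eq fun a ↦ (φ.commutes a).symm
  have : Module.Flat B (Germ l A) := flat_germ_of_maximalIdeal_eq_map hmax
  exact faithfullyFlat_of_maximalIdeal_eq_map hmax

theorem mainTheorem3
    {A B X : Type*}
    [CommRing A] [IsLocalRing A] [IsNoetherianRing A]
    [CommRing B] [IsLocalRing B] [IsNoetherianRing B]
    [Algebra A B] [Module.Flat A B]
    (hmax : IsLocalRing.maximalIdeal B =
      (IsLocalRing.maximalIdeal A).map (algebraMap A B))
    (U : Ultrafilter X)
    (φ : B →ₐ[A] Ultrapower A U) :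
    (φ : B →+* Ultrapower A U).FaithfullyFlat := by
  exact mainTheorem3_general hmax (U : Filter X) φ
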